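/- Let $N\in\mathbb{N}$, let $\mathcal{D}\subset\mathbb{R}^N$ be open, bounded and connected, let $\mathbf{p}\in(1,\infty)$, and let $\gamma,a>0$ satisfy $\frac{N+2}{\gamma^2}+a^2=\mathbf{p}-1$ and, in addition, either ($a\le 1$ and $\gamma a>1$) or ($a\ge 1$ and $\gamma>1$). **The game.** Let $\Omega_1=B(0,1)\times\{1,2\}\times(0,1)$, where $B(0,1)\subset\mathbb{R}^N$ is the open unit ball, with the product $\mathbb{P}_1$ of the normalised Lebesgue measure on $B(0,1)$, the uniform measure on $\{1,2\}$ and the Lebesgue measure on $(0,1)$; let $(\Omega,\mathbb{P})$ be the countable product of copies of $(\Omega_1,\mathbb{P}_1)$, with elements $\omega=\{(w_n,s_n,t_n)\}_{n\ge1}$. A strategy is a sequence $\sigma=\{\sigma^n\}_{n\ge 0}$ of Borel measurable maps $\sigma^n:\mathbb{R}^N\times(\mathbb{R}^N\times\Omega_1)^n\to B(0,1)$. Given $\epsilon\in(0,1)$, a starting point $x\in\mathbb{R}^N$ and strategies $\sigma_I,\sigma_{II}$, put $X_0=x$ and, for $n\ge1$, $$X_n=X_{n-1}+\epsilon\big(v_n+\gamma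 w_n+\gamma(a-1)\langle w_n,v_n\rangle v_n\big),\qquad v_n=\begin{cases}\sigma_I^{n-1}(h_{n-1})& s_n=1,\\ \sigma_{II}^{n-1}(h_{n-1})& s_n=2,\end{cases}$$ where $h_{n-1}=\big(X_0,(X_1,w_1,s_1,t_1),\dots,(X_{n-1},w_{n-1},s_{n-1},t_{n-1})\big)$. Let $d_\epsilon(y)=\frac1\epsilon\min\{\epsilon,\mathrm{dist}(y,\mathbb{R}^N\setminus\mathcal{D})\}$ and $\tau=\min\{n\ge1:\ t_n>d_\epsilon(X_{n-1})\}\in\mathbb{N}\cup\{\infty\}$. **Game-regularity.** A point $x_0\in\partial\mathcal{D}$ is *game-regular* if for every $\eta,\delta>0$ there exist $\hat\delta\in(0,\delta)$ and $\hat\epsilon\in(0,1)$ such that for every $\epsilon\in(0,\hat\epsilon)$ and every $x\in B(x_0,\hat\delta)$ there is a strategy $\sigma_{0,I}$ such that, for every strategy $\sigma_{II}$, the game started at $x$ and played with $\sigma_{0,I},\sigma_{II}$ satisfies $$\mathbb{P}\big(\tau<\infty\ \text{ and }\ X_{\tau-1}\in B(x_0,\delta)\big)\ge 1-\eta .$$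 **Exterior corkscrew condition.** A point $x_0\in\partial\mathcal{D}$ satisfies the *exterior corkscrew condition* if there exists $\mu\in(0,1)$ such that for all sufficiently small $r>0$ there is a ball $B(y,\mu r)\subset B(x_0,r)\setminus\bar{\mathcal{D}}$. **Theorem.** If $x_0\in\partial\mathcal{D}$ satisfies the exterior corkscrew condition, then $x_0$ is game-regular. -/

import Mathlib

namespace TugOfWar

open MeasureTheory Metric Set

/-- Euclidean space `ℝ^N`. -/
abbrev E (N : ℕ) : Type := EuclideanSpace ℝ (Fin N)

/-- The outcomes `(w, s, t) ∈ B(0,1) × {1,2} × (0,1)` of one round. The coin values `1, 2` of the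
game are the elements `0, 1` of `Fin 2`: the value `0` activates Player I, `1` Player II. -/
abbrev Outcome (N : ℕ) : Type := ball (0 : E N) 1 × Fin 2 × Ioo (0 : ℝ) 1

/-- Normalised Lebesgue measure on the open unit ball of `ℝ^N`. -/
noncomputable def ballMeasure (N : ℕ) : Measure (ball (0 : E N) 1) :=
  (volume (ball (0 : E N) 1))⁻¹ • (volume : Measure (E N)).comap Subtype.val

/-- Lebesgue measure on the interval `(0,1)`. -/
noncomputable def intervalMeasure : Measure (Ioo (0 : ℝ) 1) :=
  (volume : Measure ℝ).comap Subtype.val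

/-- The law of one round. -/
noncomputable def roundMeasure (N : ℕ) : Measure (Outcome N) :=
  (ballMeasure N).prod
    ((ProbabilityTheory.uniformOn (univ : Set (Fin 2))).prod intervalMeasure)

instance (N : ℕ) : IsProbabilityMeasure (ballMeasure N) := by
  constructor
  have h : (volume : Measure (E N)).comap (Subtype.val : ball (0 : E N) 1 → E N) univ
      = volume (ball (0 : E N) 1) := by
    rw [comap_subtype_coe_apply measurableSet_ball, image_univ, Subtype.range_coe]
  rw [ballMeasure, Measure.smul_apply, h, smul_eq_mul]
  exact ENNReal.inv_mul_cancel (measure_ball_pos _ _ one_pos).ne' measure_ball_lt_top.ne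

instance : IsProbabilityMeasure intervalMeasure := by
  constructor
  rw [intervalMeasure, comap_subtype_coe_apply measurableSet_Ioo, image_univ, Subtype.range_coe,
    Real.volume_Ioo]
  norm_num

instance : IsProbabilityMeasure (ProbabilityTheory.uniformOn (univ : Set (Fin 2))) :=
  ProbabilityTheory.isProbabilityMeasure_uniformOn finite_univ univ_nonempty

instance (N : ℕ) : IsProbabilityMeasure (roundMeasure N) := by
  unfold roundMeasure
  infer_instance

/-- The probability space of the game: sequences of outcomes, `ω n` being the outcome
`(w_{n+1}, s_{n+1}, t_{n+1})` of round `n + 1`. -/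
abbrev Path (N : ℕ) : Type := ℕ → Outcome N

/-- The countable product of the laws of the rounds. -/
noncomputable def gameMeasure (N : ℕ) : Measure (Path N) :=
  Measure.infinitePi (fun _ : ℕ => roundMeasure N)

/-- Histories of length `n`: the initial position `x_0`, followed by the positions and outcomes
`(x_1, w_1, s_1, t_1), …, (x_n, w_n, s_n, t_n)`. -/
abbrev History (N n : ℕ) : Type := E N × (Fin n → E N × Outcome N)

/-- The current position `x_n` recorded in a history of length `n`. -/
def History.current {N : ℕ} : (n : ℕ) → History N n → E N
  | 0, h => h.1
  | n + 1, h => (h.2 (Fin.last n)).1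

/-- A strategy: a family of Borel measurable maps from histories to the open unit ball. -/
structure Strategy (N : ℕ) where
  move : (n : ℕ) → History N n → ball (0 : E N) 1
  measurable_move : ∀ n, Measurable (move n)

/-- The displacement of the token, when the active player chooses `v` and the noise is `w`. -/
noncomputable def displacement {N : ℕ} (γ a ε : ℝ) (v w : E N) : E N :=
  ε • (v + γ • w + (γ * (a - 1) * inner ℝ w v) • v)

/-- The vector chosen by the player whom the coin `s` activates. -/
def activeMove {N : ℕ} (σI σII : Strategy N) (n : ℕ) (h : History N n) (s : Fin 2) :
    ball (0 : E N) 1 :=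
  if s = 0 then σI.move n h else σII.move n h

/-- The history `h_n` of the game started at `x`. -/
noncomputable def history {N : ℕ} (γ a ε : ℝ) (x : E N) (σI σII : Strategy N) (ω : Path N) :
    (n : ℕ) → History N n
  | 0 => (x, Fin.elim0)
  | n + 1 =>
    let h := history γ a ε x σI σII ω n
    (h.1, Fin.snoc h.2
      (h.current n + displacement γ a ε (activeMove σI σII n h (ω n).2.1) (ω n).1, ω n))

/-- The position `X_n` of the token after `n` rounds. -/
noncomputable def position {N : ℕ} (γ a ε : ℝ) (x : E N) (σI σII : Strategy N) (n : ℕ)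
    (ω : Path N) : E N :=
  (history γ a ε x σI σII ω n).current n

/-- The truncated and scaled distance `d_ε` from the complement of `D`. -/
noncomputable def scaledDist {N : ℕ} (D : Set (E N)) (ε : ℝ) (x : E N) : ℝ :=
  1 / ε * min ε (infDist x Dᶜ)

/-- The stopping time `τ = min {n ≥ 1 : t_n > d_ε(X_{n-1})}`, equal to `∞` if there is no such
`n`. -/
noncomputable def stopTime {N : ℕ} (D : Set (E N)) (γ a ε : ℝ) (x : E N) (σI σII : Strategy N)
    (ω : Path N) : ℕ∞ :=
  sInf {m : ℕ∞ | ∃ n : ℕ, m = (n : ℕ∞) + 1 ∧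
    scaledDist D ε (position γ a ε x σI σII n ω) < ((ω n).2.2 : ℝ)}

/-- The event that the game stops, at a position `X_{τ-1}` in `A`. -/
def stopsIn {N : ℕ} (D : Set (E N)) (γ a ε : ℝ) (x : E N) (σI σII : Strategy N)
    (A : Set (E N)) : Set (Path N) :=
  {ω | ∃ n : ℕ, stopTime D γ a ε x σI σII ω = (n : ℕ∞) + 1 ∧ position γ a ε x σI σII n ω ∈ A}

/-- Game-regularity of a boundary point `x₀` of `D`. -/
def GameRegular {N : ℕ} (D : Set (E N)) (γ a : ℝ) (x₀ : E N) : Prop :=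
  ∀ η : ℝ, 0 < η → ∀ δ : ℝ, 0 < δ → ∃ δ' ∈ Ioo (0 : ℝ) δ, ∃ ε' ∈ Ioo (0 : ℝ) 1,
    ∀ ε ∈ Ioo (0 : ℝ) ε', ∀ x ∈ ball x₀ δ', ∃ σI : Strategy N, ∀ σII : Strategy N,
      1 - η ≤ (gameMeasure N).real (stopsIn D γ a ε x σI σII (ball x₀ δ))

/-- The exterior corkscrew condition for `D` at `x₀`. -/
def ExteriorCorkscrew {N : ℕ} (D : Set (E N)) (x₀ : E N) : Prop :=
  ∃ μ ∈ Ioo (0 : ℝ) 1, ∃ r₀ : ℝ, 0 < r₀ ∧ ∀ r ∈ Ioo (0 : ℝ) r₀,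
    ∃ y : E N, ball y (μ * r) ⊆ ball x₀ r \ closure D

end TugOfWar

namespace TugOfWar

open MeasureTheory Metric Set

/-! The corkscrew condition gives a ball of radius `μ * r` and centre `y`, disjoint from `D` and
contained in `B(x₀, r)`. Player I always pulls towards `y`. Then `-exp (-b |x - y|²)` drops on
average in each round, whatever Player II does. Player II can at best push straight away from `y`,
so to first order the two moves compensate up to `O(ε³)`. The noise is centred, and for large `b`
the negative second-order term `-b² ε² |x - y|²` beats the term `b ε² L²` due to the squared
displacement.

Normalised, this function is a barrier (`exists_barrier_of_ball`): at least `1` off `B(x₀, 4r)` and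
at most `θ < 1` on `B(x₀, r)`, with `θ` independent of `r`. Nested barriers are glued by taking
minima (`IsBarrier.glue`), so their bounds multiply and become arbitrarily small near `x₀`
(`exists_barrier`).

A supermartingale argument concludes (`IsBarrier.one_sub_le_prob_stopsIn`). The uniform drop forces
the token out of `D ∩ B(x₀, δ)`; it leaves the ball first with probability at most `V x`; otherwise
it reaches a point of the ball outside `D`, where the game stops at once if it has not stopped
before. -/

/-- The position after one round with outcome `o` started at `x`, when the players choose `vI` and
`vII`. -/
noncomputable def nextPosition {N : ℕ} (γ a ε : ℝ) (x : E N) (vI vII : ball (0 : E N) 1)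
    (o : Outcome N) : E N :=
  x + displacement γ a ε ((if o.2.1 = 0 then vI else vII : ball (0 : E N) 1) : E N) o.1

/-! ### Measurability and length of one step. -/

variable {N : ℕ}

lemma measurable_displacement (γ a ε : ℝ) :
    Measurable fun p : E N × E N => displacement γ a ε p.1 p.2 := by
  unfold displacement
  fun_prop

lemma measurable_ite_coin {α β : Type*} [MeasurableSpace α] [MeasurableSpace β] {f g : α → β}
    {o : α → Outcome N} (hf : Measurable f) (hg : Measurable g) (ho : Measurable o) :
    Measurable fun z => if (o z).2.1 = 0 then f z else g z :=
  Measurable.ite ((measurable_fst.comp (measurable_snd.comp ho)) (measurableSet_singleton 0)) hf hg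

lemma measurable_nextPosition {α : Type*} [MeasurableSpace α] {γ a ε : ℝ} {x : α → E N}
    {vI vII : α → ball (0 : E N) 1} {o : α → Outcome N} (hx : Measurable x)
    (hI : Measurable vI) (hII : Measurable vII) (ho : Measurable o) :
    Measurable fun z => nextPosition γ a ε (x z) (vI z) (vII z) (o z) := by
  have h := (measurable_displacement γ a ε).comp
    ((measurable_ite_coin hI hII ho).subtype_val.prodMk (measurable_fst.comp ho).subtype_val)
  exact hx.add h

lemma measurable_nextPosition_right {γ a ε : ℝ} (x : E N) (vI vII : ball (0 : E N) 1) :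
    Measurable (nextPosition γ a ε x vI vII) :=
  measurable_nextPosition measurable_const measurable_const measurable_const measurable_id

lemma norm_displacement_le {γ a ε : ℝ} (hγ : 0 ≤ γ) (hε : 0 ≤ ε) {v w : E N} (hv : ‖v‖ ≤ 1)
    (hw : ‖w‖ ≤ 1) : ‖displacement γ a ε v w‖ ≤ ε * (1 + γ + γ * |a - 1|) := by
  unfold displacement
  rw [norm_smul, Real.norm_of_nonneg hε]
  gcongr
  have h1 : |inner ℝ w v| ≤ 1 :=
    (abs_real_inner_le_norm w v).trans (mul_le_one₀ hw (norm_nonneg _) hv)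
  have h2 : ‖γ • w‖ ≤ γ := by
    rw [norm_smul, Real.norm_of_nonneg hγ]
    exact mul_le_of_le_one_right hγ hw
  have h3 : ‖(γ * (a - 1) * inner ℝ w v) • v‖ ≤ γ * |a - 1| := by
    rw [norm_smul, Real.norm_eq_abs, abs_mul, abs_mul, abs_of_nonneg hγ]
    calc γ * |a - 1| * |inner ℝ w v| * ‖v‖ ≤ γ * |a - 1| * 1 * 1 := by gcongr
      _ = _ := by ring
  calc _ ≤ ‖v‖ + ‖γ • w‖ + ‖(γ * (a - 1) * inner ℝ w v) • v‖ := norm_add₃_le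
    _ ≤ _ := by gcongr

/-! ### Averages over one round. -/

lemma integral_inner_ballMeasure (q : E N) :
    ∫ w, inner ℝ q (w : E N) ∂ballMeasure N = 0 := by
  have h : ∫ w : ball (0 : E N) 1, inner ℝ q (w : E N) ∂(volume : Measure (E N)).comap Subtype.val
      = 0 := by
    rw [integral_subtype_comap measurableSet_ball (fun w : E N => inner ℝ q w),
      ← integral_indicator measurableSet_ball]
    set f : E N → ℝ := (ball (0 : E N) 1).indicator fun w => inner ℝ q w
    have hf : ∀ w, f (-w) = -f w := by
      intro w
      by_cases hw : w ∈ ball (0 : E N) 1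
      · have hw' : -w ∈ ball (0 : E N) 1 := by simpa using hw
        simp only [f, indicator_of_mem hw, indicator_of_mem hw', inner_neg_right]
      · have hw' : -w ∉ ball (0 : E N) 1 := by simpa using hw
        simp only [f, indicator_of_notMem hw, indicator_of_notMem hw', neg_zero]
    have := integral_neg_eq_self f (volume : Measure (E N))
    simp only [hf, integral_neg] at this
    linarith
  rw [ballMeasure, integral_smul_measure, h, smul_zero]

lemma integrable_of_bounded {α : Type*} [MeasurableSpace α] {ν : Measure α} [IsFiniteMeasure ν]
    {f : α → ℝ} (hf : Measurable f) {C : ℝ} (h0 : ∀ x, 0 ≤ f x) (hC : ∀ x, f x ≤ C) :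
    Integrable f ν :=
  Integrable.of_bound hf.aestronglyMeasurable C
    (Filter.Eventually.of_forall fun x => by rw [Real.norm_of_nonneg (h0 x)]; exact hC x)

lemma integral_uniformOn_fin_two (f : Fin 2 → ℝ) :
    ∫ s, f s ∂ProbabilityTheory.uniformOn (univ : Set (Fin 2)) = (f 0 + f 1) / 2 := by
  rw [integral_fintype (Integrable.of_finite)]
  have : ∀ s : Fin 2, (ProbabilityTheory.uniformOn (univ : Set (Fin 2))).real {s} = 1 / 2 := by
    intro s
    simp [Measure.real, ProbabilityTheory.uniformOn_univ]
  simp [this]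
  ring

lemma integrable_affine_roundMeasure (α : Fin 2 → ℝ) (q : Fin 2 → E N) :
    Integrable (fun o : Outcome N => α o.2.1 + inner ℝ (q o.2.1) (o.1 : E N))
      (roundMeasure N) := by
  have hα : Measurable α := measurable_of_finite α
  have hq : Measurable q := measurable_of_finite q
  refine Integrable.of_bound (C := |α 0| + |α 1| + (‖q 0‖ + ‖q 1‖)) ?_
    (Filter.Eventually.of_forall fun o => ?_)
  · exact (by fun_prop : Measurable _).aestronglyMeasurable
  · have hw : ‖(o.1 : E N)‖ ≤ 1 := (mem_ball_zero_iff.1 o.1.2).le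
    have h1 : ‖inner ℝ (q o.2.1) (o.1 : E N)‖ ≤ ‖q o.2.1‖ :=
      (norm_inner_le_norm _ _).trans (mul_le_of_le_one_right (norm_nonneg _) hw)
    refine (norm_add_le _ _).trans (add_le_add ?_ (h1.trans ?_)) <;>
      generalize o.2.1 = s <;> fin_cases s <;> simp

lemma integral_affine_roundMeasure (α : Fin 2 → ℝ) (q : Fin 2 → E N) :
    ∫ o : Outcome N, (α o.2.1 + inner ℝ (q o.2.1) (o.1 : E N)) ∂roundMeasure N
      = (α 0 + α 1) / 2 := by
  have hi := integrable_affine_roundMeasure α q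
  rw [roundMeasure] at hi ⊢
  rw [integral_prod_symm _ hi]
  have h1 : ∀ st : Fin 2 × Ioo (0 : ℝ) 1,
      ∫ w, (α st.1 + inner ℝ (q st.1) (w : E N)) ∂ballMeasure N = α st.1 := by
    intro st
    rw [integral_add (integrable_const _), integral_inner_ballMeasure]
    · simp
    · refine Integrable.of_bound (C := ‖q st.1‖) ?_ (Filter.Eventually.of_forall fun w => ?_)
      · exact (by fun_prop : Measurable _).aestronglyMeasurable
      · exact (norm_inner_le_norm _ _).trans (mul_le_of_le_one_right (norm_nonneg _)
          (mem_ball_zero_iff.1 w.2).le)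
  simp only [h1]
  rw [integral_fun_fst (f := α)]
  simp [integral_uniformOn_fin_two]

/-! ### Average drop of the radial exponential under a pull towards `y`. -/

/-- A second-order lower bound for the exponential. -/
lemma one_sub_exp_neg_le {t : ℝ} (ht : |t| ≤ 1) :
    1 - Real.exp (-t) ≤ t - t ^ 2 / 2 + |t| ^ 3 := by
  have h := Real.exp_bound (x := -t) (by simpa using ht) (n := 3) (by norm_num)
  simp [Finset.sum_range_succ, Nat.factorial] at h
  have h2 := (abs_le.1 h).1
  have : |t| ^ 3 * (4 / (6 * 3)) ≤ |t| ^ 3 := by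
    nlinarith [pow_nonneg (abs_nonneg t) 3]
  linarith

/-- Second-order Taylor expansion, arranged to be affine in the noise `w`: the linear part averages
to zero, and no second moments are needed because `|z|²` is bounded by `L²`. -/
lemma exp_increment_le {γ a ε b M L : ℝ} (hγ : 0 ≤ γ) (hε : 0 < ε) (hε1 : ε ≤ 1) (hb : 0 < b)
    (hL : L = 1 + γ + γ * |a - 1|) {d v w : E N} (hd : ‖d‖ ≤ M) (hv : ‖v‖ ≤ 1) (hw : ‖w‖ ≤ 1)
    (hsmall : ε * (b * (2 * M * L + L ^ 2)) ≤ 1) :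
    1 - Real.exp (-(b * (‖d + displacement γ a ε v w‖ ^ 2 - ‖d‖ ^ 2)))
      ≤ (2 * b * ε * inner ℝ d v + b * ε ^ 2 * L ^ 2 - 2 * b ^ 2 * ε ^ 2 * (inner ℝ d v) ^ 2
        + (2 * b ^ 2 * M * L ^ 3 + (b * (2 * M * L + L ^ 2)) ^ 3) * ε ^ 3)
        + inner ℝ ((2 * b * ε - 4 * b ^ 2 * ε ^ 2 * inner ℝ d v) •
          (γ • d + (γ * (a - 1) * inner ℝ d v) • v)) w := by
  set c : ℝ := inner ℝ d v with hc
  set z : E N := v + γ • w + (γ * (a - 1) * inner ℝ w v) • v with hz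
  have hL0 : 0 < L := by rw [hL]; positivity
  have hM0 : 0 ≤ M := (norm_nonneg d).trans hd
  have hdz : displacement γ a ε v w = ε • z := rfl
  have hzL : ‖z‖ ≤ L := by
    have h := norm_displacement_le (a := a) hγ hε.le hv hw
    rw [hdz, norm_smul, Real.norm_of_nonneg hε.le, ← hL] at h
    exact le_of_mul_le_mul_left h hε
  set l : ℝ := inner ℝ (γ • d + (γ * (a - 1) * c) • v) w with hl
  have hP : inner ℝ d z = c + l := by
    simp only [hz, hl, inner_add_right, inner_add_left, inner_smul_right, inner_smul_left, ← hc,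
      real_inner_comm v w, conj_trivial]
    ring
  rw [inner_smul_left, ← hl, conj_trivial]
  set P : ℝ := inner ℝ d z
  set Q : ℝ := ‖z‖ ^ 2
  have hQ0 : 0 ≤ Q := sq_nonneg _
  have hQL : Q ≤ L ^ 2 := pow_le_pow_left₀ (norm_nonneg _) hzL 2
  have hPL : |P| ≤ M * L :=
    (abs_real_inner_le_norm d z).trans (mul_le_mul hd hzL (norm_nonneg _) hM0)
  have ht : ‖d + displacement γ a ε v w‖ ^ 2 - ‖d‖ ^ 2 = 2 * ε * P + ε ^ 2 * Q := by
    rw [hdz, norm_add_sq_real, inner_smul_right, norm_smul, Real.norm_of_nonneg hε.le, mul_pow]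
    ring
  rw [ht]
  set H : ℝ := b * (2 * M * L + L ^ 2)
  have hPabs := abs_le.1 hPL
  have hε2 : ε ^ 2 * Q ≤ ε * L ^ 2 :=
    mul_le_mul (by nlinarith) hQL hQ0 hε.le
  have hT : |b * (2 * ε * P + ε ^ 2 * Q)| ≤ ε * H := by
    rw [abs_mul, abs_of_pos hb]
    have h1 : |2 * ε * P + ε ^ 2 * Q| ≤ 2 * ε * (M * L) + ε * L ^ 2 := by
      refine (abs_add_le _ _).trans (add_le_add ?_ ?_)
      · rw [abs_mul, abs_of_pos (by positivity)]
        gcongr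
      · rwa [abs_of_nonneg (by positivity)]
    calc b * |2 * ε * P + ε ^ 2 * Q| ≤ b * (2 * ε * (M * L) + ε * L ^ 2) := by gcongr
      _ = ε * H := by ring
  have h3 : |b * (2 * ε * P + ε ^ 2 * Q)| ^ 3 ≤ (ε * H) ^ 3 := by gcongr
  have hexp := one_sub_exp_neg_le (hT.trans hsmall)
  have hPQ : -(M * L * L ^ 2) ≤ P * Q := by
    have : |P * Q| ≤ M * L * L ^ 2 := by
      rw [abs_mul, abs_of_nonneg hQ0]
      exact mul_le_mul hPL hQL hQ0 (by positivity)
    exact (abs_le.1 this).1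
  -- The terms in `l ^ 2` and `Q ^ 2` have the favourable sign and are dropped, which leaves an
  -- expression affine in `w`.
  have hsq : 4 * ε ^ 2 * (c ^ 2 + 2 * c * l) - 4 * ε ^ 3 * (M * L * L ^ 2)
      ≤ (2 * ε * P + ε ^ 2 * Q) ^ 2 := by
    have e : (2 * ε * P + ε ^ 2 * Q) ^ 2
        = 4 * ε ^ 2 * (c ^ 2 + 2 * c * l) + 4 * ε ^ 3 * (P * Q)
          + (4 * ε ^ 2 * l ^ 2 + ε ^ 4 * Q ^ 2) := by
      rw [hP]
      ring
    have h4 : 4 * ε ^ 3 * -(M * L * L ^ 2) ≤ 4 * ε ^ 3 * (P * Q) := by gcongr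
    have h5 : 0 ≤ 4 * ε ^ 2 * l ^ 2 + ε ^ 4 * Q ^ 2 := by positivity
    rw [e]
    linarith
  have h6 : b ^ 2 / 2 * (4 * ε ^ 2 * (c ^ 2 + 2 * c * l) - 4 * ε ^ 3 * (M * L * L ^ 2))
      ≤ b ^ 2 / 2 * (2 * ε * P + ε ^ 2 * Q) ^ 2 := by gcongr
  have h7 : b * (ε ^ 2 * Q) ≤ b * (ε ^ 2 * L ^ 2) := by gcongr
  rw [hP] at h3 hexp h6 ⊢
  linarith

/-- The vector of length less than one that points from `x` to `y`, up to a defect `ε ^ 2`. -/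
noncomputable def pullMove (y : E N) (ε : ℝ) (hε : ε ∈ Ioo (0 : ℝ) 1) (x : E N) :
    ball (0 : E N) 1 :=
  -- Moves must lie in the open ball; the defect `ε ^ 2` costs only `O(ε³)` in the drop. At `x = y`
  -- the move is zero.
  ⟨-((1 - ε ^ 2) / ‖x - y‖) • (x - y), by
    have h1 : 0 < 1 - ε ^ 2 := by nlinarith [hε.1, hε.2]
    rw [mem_ball_zero_iff, norm_smul, norm_neg, Real.norm_eq_abs, abs_div, abs_norm,
      abs_of_pos h1]
    calc (1 - ε ^ 2) / ‖x - y‖ * ‖x - y‖ ≤ 1 - ε ^ 2 := by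
          by_cases h : ‖x - y‖ = 0
          · simpa [h] using h1.le
          · rw [div_mul_cancel₀ _ h]
      _ < 1 := by nlinarith [hε.1]⟩

lemma measurable_pullMove (y : E N) (ε : ℝ) (hε : ε ∈ Ioo (0 : ℝ) 1) :
    Measurable (pullMove y ε hε) := by
  refine Measurable.subtype_mk ?_
  fun_prop

lemma inner_pullMove {y x : E N} {ε : ℝ} (hε : ε ∈ Ioo (0 : ℝ) 1) (hx : 0 < ‖x - y‖) :
    inner ℝ (x - y) (pullMove y ε hε x : E N) = -((1 - ε ^ 2) * ‖x - y‖) := by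
  simp only [pullMove, inner_smul_right, real_inner_self_eq_norm_sq]
  field_simp

lemma integrable_exp_increment {γ a ε b : ℝ} (hb : 0 ≤ b) (x y : E N)
    (vI vII : ball (0 : E N) 1) :
    Integrable (fun o => 1 - Real.exp (-(b * (‖nextPosition γ a ε x vI vII o - y‖ ^ 2
      - ‖x - y‖ ^ 2)))) (roundMeasure N) := by
  have hm := measurable_nextPosition_right (γ := γ) (a := a) (ε := ε) x vI vII
  refine (integrable_const 1).sub (integrable_of_bounded (C := Real.exp (b * ‖x - y‖ ^ 2))
    (by fun_prop) (fun o => (Real.exp_pos _).le) fun o => Real.exp_le_exp.2 ?_)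
  nlinarith [sq_nonneg ‖nextPosition γ a ε x vI vII o - y‖]

lemma integral_exp_increment_le {γ a ε b M L : ℝ} (hγ : 0 ≤ γ) (hε : ε ∈ Ioo (0 : ℝ) 1)
    (hb : 0 < b) (hL : L = 1 + γ + γ * |a - 1|) {x y : E N} (hM : ‖x - y‖ ≤ M)
    (hx : 0 < ‖x - y‖) (hbx : L ^ 2 + 1 ≤ b * ‖x - y‖ ^ 2)
    (hsmall : ε * (b * (2 * M * L + L ^ 2)) ≤ 1) (hsmall' : 2 * b * ε * M ≤ 1)
    (hC : ε * (b * M + (2 * b ^ 2 * M * L ^ 3 + (b * (2 * M * L + L ^ 2)) ^ 3)) ≤ b / 2)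
    (v : ball (0 : E N) 1) :
    ∫ o, (1 - Real.exp (-(b * (‖nextPosition γ a ε x (pullMove y ε hε x) v o - y‖ ^ 2
        - ‖x - y‖ ^ 2)))) ∂roundMeasure N ≤ -(ε ^ 2 * b / 2) := by
  set vs : Fin 2 → E N := fun s => ((if s = 0 then pullMove y ε hε x else v : ball (0 : E N) 1))
  have hvs : ∀ s, ‖vs s‖ ≤ 1 := fun s =>
    (mem_ball_zero_iff.1 (if s = 0 then pullMove y ε hε x else v).2).le
  set C : ℝ := 2 * b ^ 2 * M * L ^ 3 + (b * (2 * M * L + L ^ 2)) ^ 3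
  set α : Fin 2 → ℝ := fun s => 2 * b * ε * inner ℝ (x - y) (vs s) + b * ε ^ 2 * L ^ 2
    - 2 * b ^ 2 * ε ^ 2 * (inner ℝ (x - y) (vs s)) ^ 2 + C * ε ^ 3 with hα
  set q : Fin 2 → E N := fun s => (2 * b * ε - 4 * b ^ 2 * ε ^ 2 * inner ℝ (x - y) (vs s)) •
          (γ • (x - y) + (γ * (a - 1) * inner ℝ (x - y) (vs s)) • vs s)
  have hpt : ∀ o : Outcome N, 1 - Real.exp (-(b *
      (‖nextPosition γ a ε x (pullMove y ε hε x) v o - y‖ ^ 2 - ‖x - y‖ ^ 2)))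
      ≤ α o.2.1 + inner ℝ (q o.2.1) (o.1 : E N) := by
    intro o
    have := exp_increment_le (a := a) hγ hε.1 hε.2.le hb hL hM (hvs o.2.1)
      (mem_ball_zero_iff.1 o.1.2).le hsmall
    rwa [← add_sub_right_comm] at this
  refine (integral_mono (integrable_exp_increment hb.le _ _ _ _)
    (integrable_affine_roundMeasure α q) hpt).trans ?_
  rw [integral_affine_roundMeasure]
  have h0 : inner ℝ (x - y) (vs 0) = -((1 - ε ^ 2) * ‖x - y‖) := by
    simpa [vs] using inner_pullMove hε hx
  have h1 : |inner ℝ (x - y) (vs 1)| ≤ ‖x - y‖ :=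
    (abs_real_inner_le_norm _ _).trans (mul_le_of_le_one_right (norm_nonneg _) (hvs 1))
  simp only [hα, h0]
  generalize (inner ℝ (x - y) (vs 1) : ℝ) = c at h1 ⊢
  obtain ⟨ε0, ε1⟩ := hε
  generalize ‖x - y‖ = s at *
  obtain ⟨-, h1⟩ := abs_le.1 h1
  -- Player II's contribution `2bεc - 2b²ε²c²` is largest at `c = s`, the push straight away from
  -- `y`, because `bε(s + c) ≤ 1`.
  have hmono : 0 ≤ b * ε * ((s - c) * (1 - b * ε * (s + c))) := by
    have : b * ε * (s + c) ≤ b * ε * (2 * M) := by gcongr; linarith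
    have : 0 ≤ (s - c) * (1 - b * ε * (s + c)) :=
      mul_nonneg (by linarith) (by linarith)
    positivity
  have hs1 : b * ε ^ 2 * (L ^ 2 + 1) ≤ b * ε ^ 2 * (b * s ^ 2) := by gcongr
  have hs2 : b * ε ^ 3 * s ≤ b * ε ^ 3 * M := by gcongr
  have hs3 : ε ^ 2 * (ε * (b * M + C)) ≤ ε ^ 2 * (b / 2) := by gcongr
  -- Player I's quadratic term only helps and is discarded; Player II's alone yields `-b²ε²s²` in
  -- the average.
  have hs4 : 0 ≤ b ^ 2 * ε ^ 2 * ((1 - ε ^ 2) * s) ^ 2 := by positivity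
  nlinarith

/-! ### Barriers: one scale, gluing, iteration. -/

/-- A bounded function `V` that is at least `1` outside `B(x₀, δ)` and at most `q` on `B(x₀, δ')`,
and that decreases on average in each round played in `D ∩ B(x₀, δ)`, if Player I uses the move
`σ` prescribed by the current position. -/
structure IsBarrier (D : Set (E N)) (γ a ε : ℝ) (x₀ : E N) (δ δ' q : ℝ) (V : E N → ℝ)
    (σ : E N → ball (0 : E N) 1) : Prop where
  measurable : Measurable V
  measurable_move : Measurable σ
  nonneg : ∀ x, 0 ≤ V x
  bounded : ∃ C, ∀ x, V x ≤ C
  one_le : ∀ x, x ∉ ball x₀ δ → 1 ≤ V x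
  le : ∀ x ∈ ball x₀ δ', V x ≤ q
  decrease : ∃ c, 0 < c ∧ ∀ x ∈ D ∩ ball x₀ δ, ∀ v,
    ∫ o, V (nextPosition γ a ε x (σ x) v o) ∂roundMeasure N ≤ V x - c

lemma norm_nextPosition_sub_le {γ a ε : ℝ} (hγ : 0 ≤ γ) (hε : 0 ≤ ε) (x : E N)
    (vI vII : ball (0 : E N) 1) (o : Outcome N) :
    ‖nextPosition γ a ε x vI vII o - x‖ ≤ ε * (1 + γ + γ * |a - 1|) := by
  rw [nextPosition, add_sub_cancel_left]
  exact norm_displacement_le hγ hε (mem_ball_zero_iff.1 (Subtype.prop _)).le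
    (mem_ball_zero_iff.1 o.1.2).le

lemma eventually_mul_le (k : ℝ) {c : ℝ} (hc : 0 < c) :
    ∀ᶠ ε in nhdsWithin (0 : ℝ) (Ioi 0), ε * k ≤ c := by
  have h : Filter.Tendsto (fun ε : ℝ => ε * k) (nhdsWithin 0 (Ioi 0)) (nhds 0) := by
    have : Continuous fun ε : ℝ => ε * k := by fun_prop
    simpa using (this.tendsto 0).mono_left nhdsWithin_le_nhds
  exact (h.eventually_lt_const hc).mono fun _ => le_of_lt

/-- The exponent is a function of `|x - y| / r` alone, so `θ` is chosen before `r`; only the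
admissible `ε` depend on the scale. -/
lemma exists_barrier_of_ball {γ : ℝ} (a : ℝ) (hγ : 0 < γ) {μ : ℝ} (hμ : μ ∈ Ioo (0 : ℝ) 1) :
    ∃ θ ∈ Ioo (0 : ℝ) 1, ∀ (D : Set (E N)) (x₀ y : E N) (r : ℝ), 0 < r → ‖y - x₀‖ < r →
      (∀ x ∈ D, μ * r ≤ ‖x - y‖) → ∀ᶠ ε in nhdsWithin (0 : ℝ) (Ioi 0),
        ∃ V σ, IsBarrier D γ a ε x₀ (4 * r) r θ V σ := by
  obtain ⟨hμ0, hμ1⟩ := hμ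
  set L : ℝ := 1 + γ + γ * |a - 1| with hL
  have hL0 : 0 < L := by positivity
  -- Chosen so that `b |x - y|² ≥ L² + 1` as soon as `|x - y| ≥ μ * r`, where `b = B / r²`.
  set B : ℝ := (L ^ 2 + 1) / μ ^ 2 with hB
  have hB0 : 0 < B := by positivity
  have hBμ : B * μ ^ 2 = L ^ 2 + 1 := by rw [hB]; field_simp
  -- `E₀`, `E₁`, `E₂` are the values of the exponential at distances `μr/2`, `3r`, `2r` from `y`.
  set E₀ := Real.exp (-(B * (μ / 2) ^ 2)) with hE₀
  set E₁ := Real.exp (-(B * 3 ^ 2)) with hE₁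
  set E₂ := Real.exp (-(B * 2 ^ 2)) with hE₂
  have h02 : E₂ < E₀ := Real.exp_lt_exp.2 (by
    have : (μ / 2) ^ 2 < 2 ^ 2 := by gcongr; linarith
    nlinarith)
  have h21 : E₁ < E₂ := Real.exp_lt_exp.2 (by nlinarith)
  have hE : 0 < E₀ - E₁ := by linarith
  refine ⟨(E₀ - E₂) / (E₀ - E₁), ⟨div_pos (by linarith) hE, (div_lt_one hE).2 (by linarith)⟩,
    fun D x₀ y r hr hy hD => ?_⟩
  set b : ℝ := B / r ^ 2 with hb
  have hb0 : 0 < b := by positivity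
  have hbr : ∀ k : ℝ, B * k ^ 2 = b * (k * r) ^ 2 := fun k => by rw [hb]; field_simp
  set U : E N → ℝ := fun x => (E₀ - Real.exp (-(b * ‖x - y‖ ^ 2))) / (E₀ - E₁) with hU
  have hUm : Measurable U := by fun_prop
  have hU_mono : ∀ x, ∀ k, 0 ≤ k → k * r ≤ ‖x - y‖ →
      (E₀ - Real.exp (-(B * k ^ 2))) / (E₀ - E₁) ≤ U x := by
    intro x k hk h
    simp only [hU]
    rw [hbr]
    gcongr
  have hU_mono' : ∀ x, ∀ k, ‖x - y‖ ≤ k * r →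
      U x ≤ (E₀ - Real.exp (-(B * k ^ 2))) / (E₀ - E₁) := by
    intro x k h
    simp only [hU]
    rw [hbr]
    gcongr
  filter_upwards [self_mem_nhdsWithin, eventually_mul_le 1 (c := 1 / 2) (by norm_num),
    eventually_mul_le (b * (2 * (5 * r) * L + L ^ 2)) one_pos,
    eventually_mul_le (2 * b * (5 * r)) one_pos,
    eventually_mul_le (b * (5 * r) + (2 * b ^ 2 * (5 * r) * L ^ 3
      + (b * (2 * (5 * r) * L + L ^ 2)) ^ 3)) (half_pos hb0),
    eventually_mul_le L (c := μ / 2 * r) (by positivity)] with ε hε0 h1 h2 h3 h4 h5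
  have hε : ε ∈ Ioo (0 : ℝ) 1 := ⟨hε0, by linarith⟩
  refine ⟨fun x => max 0 (U x), pullMove y ε hε, by fun_prop, measurable_pullMove y ε hε,
    fun x => le_max_left _ _, ⟨E₀ / (E₀ - E₁), fun x => max_le (by positivity) ?_⟩, fun x hx => ?_,
    fun x hx => ?_, (E₀ - E₁)⁻¹ * Real.exp (-(b * (5 * r) ^ 2)) * (ε ^ 2 * b / 2),
    have := hε.1; by positivity, fun x hx v => ?_⟩
  · simp only [hU]
    gcongr
    linarith [Real.exp_pos (-(b * ‖x - y‖ ^ 2))]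
  · refine le_max_of_le_right (le_trans ?_ (hU_mono x 3 (by norm_num) ?_))
    · rw [div_self hE.ne']
    · rw [mem_ball_iff_norm, not_lt] at hx
      have := norm_sub_le_norm_sub_add_norm_sub x y x₀
      linarith
  · refine max_le (div_nonneg (by linarith) hE.le) (hU_mono' x 2 ?_)
    rw [mem_ball_iff_norm] at hx
    have := norm_sub_le_norm_sub_add_norm_sub x x₀ y
    rw [norm_sub_rev x₀ y] at this
    linarith
  · have hxD := hD x hx.1
    have hxM : ‖x - y‖ ≤ 5 * r := by
      have hx2 := mem_ball_iff_norm.1 hx.2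
      have := norm_sub_le_norm_sub_add_norm_sub x x₀ y
      rw [norm_sub_rev x₀ y] at this
      linarith
    -- A step has length at most `μr/2`, so from `D` the token stays at distance at least `μr/2`
    -- from `y`, where the truncation at `0` is inactive.
    have hpos : ∀ o, 0 ≤ U (nextPosition γ a ε x (pullMove y ε hε x) v o) := by
      intro o
      refine le_trans ?_ (hU_mono _ (μ / 2) (by positivity) ?_)
      · simp [hE₀]
      · have := norm_nextPosition_sub_le (a := a) hγ.le hε0.le x (pullMove y ε hε x) v o
        have h6 := norm_sub_le_norm_sub_add_norm_sub x
          (nextPosition γ a ε x (pullMove y ε hε x) v o) y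
        rw [norm_sub_rev x (nextPosition _ _ _ _ _ _ _)] at h6
        linarith
    have hinc := integral_exp_increment_le (a := a) (b := b) (M := 5 * r) hγ.le hε hb0 hL hxM
      (lt_of_lt_of_le (by positivity) hxD)
      (by
        rw [← hBμ, hbr]
        gcongr) h2 (by linarith) h4 v
    have heq : ∀ o, max 0 (U (nextPosition γ a ε x (pullMove y ε hε x) v o))
        = U x + (E₀ - E₁)⁻¹ * Real.exp (-(b * ‖x - y‖ ^ 2)) * (1 - Real.exp (-(b *
          (‖nextPosition γ a ε x (pullMove y ε hε x) v o - y‖ ^ 2 - ‖x - y‖ ^ 2)))) := by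
      intro o
      rw [max_eq_right (hpos o)]
      simp only [hU]
      rw [mul_assoc, mul_sub, ← Real.exp_add]
      ring_nf
    simp only [heq]
    rw [integral_add (integrable_const _)
      ((integrable_exp_increment hb0.le _ _ _ _).const_mul _), integral_const_mul]
    simp only [integral_const, probReal_univ, one_smul]
    have h7 : (E₀ - E₁)⁻¹ * Real.exp (-(b * ‖x - y‖ ^ 2)) * (∫ o, (1 - Real.exp (-(b *
          (‖nextPosition γ a ε x (pullMove y ε hε x) v o - y‖ ^ 2 - ‖x - y‖ ^ 2))))
            ∂roundMeasure N) ≤ (E₀ - E₁)⁻¹ * Real.exp (-(b * ‖x - y‖ ^ 2))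
              * -(ε ^ 2 * b / 2) := by gcongr
    have h8 : (E₀ - E₁)⁻¹ * Real.exp (-(b * (5 * r) ^ 2)) * (ε ^ 2 * b / 2)
        ≤ (E₀ - E₁)⁻¹ * Real.exp (-(b * ‖x - y‖ ^ 2)) * (ε ^ 2 * b / 2) := by gcongr
    have := le_max_right 0 (U x)
    linarith

lemma IsBarrier.integrable {D : Set (E N)} {γ a ε : ℝ} {x₀ : E N} {δ δ' q : ℝ} {V : E N → ℝ}
    {σ : E N → ball (0 : E N) 1} (h : IsBarrier D γ a ε x₀ δ δ' q V σ) {α : Type*}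
    [MeasurableSpace α] {ν : Measure α} [IsFiniteMeasure ν] {X : α → E N} (hX : Measurable X) :
    Integrable (fun z => V (X z)) ν := by
  obtain ⟨C, hC⟩ := h.bounded
  exact integrable_of_bounded (h.measurable.comp hX) (fun _ => h.nonneg _) fun _ => hC _

open Classical in
/-- Two barriers, the inner one scaled by `q`, are glued to a barrier. -/
lemma IsBarrier.glue {D : Set (E N)} {γ a ε : ℝ} {x₀ : E N} {δ δ' q r r' θ : ℝ} {V W : E N → ℝ}
    {σ ρ : E N → ball (0 : E N) 1} (hγ : 0 ≤ γ) (hε : 0 ≤ ε) (hq : 0 < q) (hδ : δ' ≤ δ)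
    (hr : r' ≤ r) (hV : IsBarrier D γ a ε x₀ δ δ' q V σ) (hW : IsBarrier D γ a ε x₀ r r' θ W ρ)
    (hstep : r + ε * (1 + γ + γ * |a - 1|) ≤ δ') :
    IsBarrier D γ a ε x₀ δ r' (q * θ)
      (fun x => if x ∈ ball x₀ r ∧ q * W x < V x then q * W x else V x)
      (fun x => if x ∈ ball x₀ r ∧ q * W x < V x then ρ x else σ x) := by
  have hrδ' : r ≤ δ' := by
    have : 0 ≤ ε * (1 + γ + γ * |a - 1|) := by positivity
    linarith
  have hmeas : MeasurableSet {x | x ∈ ball x₀ r ∧ q * W x < V x} :=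
    measurableSet_ball.inter (measurableSet_lt (hW.measurable.const_mul q) hV.measurable)
  set Z : E N → ℝ := fun x => if x ∈ ball x₀ r ∧ q * W x < V x then q * W x else V x with hZ
  have hZm : Measurable Z := Measurable.ite hmeas (hW.measurable.const_mul q) hV.measurable
  have hZV : ∀ x, Z x ≤ V x := by
    intro x
    simp only [hZ]
    split_ifs with h
    · exact h.2.le
    · exact le_rfl
  have hZ0 : ∀ x, 0 ≤ Z x := by
    intro x
    simp only [hZ]
    split_ifs
    · exact mul_nonneg hq.le (hW.nonneg x)
    · exact hV.nonneg x
  -- Between the radii `r` and `δ'` one has `V ≤ q ≤ q * W`. A step from `B(x₀, r)` stays in `B(x₀,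
  -- δ')`, so it never sees where the inner barrier is cut off.
  have hZW : ∀ x ∈ ball x₀ δ', Z x ≤ q * W x := by
    intro x hx
    simp only [hZ]
    split_ifs with h
    · exact le_rfl
    · by_cases hxr : x ∈ ball x₀ r
      · exact not_lt.1 fun h' => h ⟨hxr, h'⟩
      · exact (hV.le x hx).trans (le_mul_of_one_le_right hq.le (hW.one_le x hxr))
  obtain ⟨C, hC⟩ := hV.bounded
  obtain ⟨c, hc0, hc⟩ := hV.decrease
  obtain ⟨d, hd0, hd⟩ := hW.decrease
  have hZi : ∀ x vI vII, Integrable (fun o => Z (nextPosition γ a ε x vI vII o))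
      (roundMeasure N) := fun x vI vII => integrable_of_bounded
    (hZm.comp (measurable_nextPosition_right _ _ _)) (fun _ => hZ0 _) fun _ => (hZV _).trans (hC _)
  refine ⟨hZm, Measurable.ite hmeas hW.measurable_move hV.measurable_move, hZ0,
    ⟨C, fun x => (hZV x).trans (hC x)⟩, fun x hx => ?_, fun x hx => ?_, min c (q * d),
    lt_min hc0 (mul_pos hq hd0), fun x hx v => ?_⟩
  · simp only [hZ]
    rw [if_neg fun h => hx (ball_subset_ball (hrδ'.trans hδ) h.1)]
    exact hV.one_le x hx
  · exact (hZW x (ball_subset_ball (hr.trans hrδ') hx)).trans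
      (mul_le_mul_of_nonneg_left (hW.le x hx) hq.le)
  · by_cases h : x ∈ ball x₀ r ∧ q * W x < V x
    · have hZx : Z x = q * W x := if_pos h
      simp only [hZx, if_pos h]
      calc ∫ o, Z (nextPosition γ a ε x (ρ x) v o) ∂roundMeasure N
          ≤ ∫ o, q * W (nextPosition γ a ε x (ρ x) v o) ∂roundMeasure N := by
            refine integral_mono (hZi _ _ _)
              ((hW.integrable (measurable_nextPosition_right _ _ _)).const_mul q) fun o => hZW _ ?_
            have h1 := norm_nextPosition_sub_le (a := a) hγ hε x (ρ x) v o
            have h2 := mem_ball_iff_norm.1 h.1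
            have h3 := norm_sub_le_norm_sub_add_norm_sub (nextPosition γ a ε x (ρ x) v o) x x₀
            rw [mem_ball_iff_norm]
            linarith
        _ ≤ q * (W x - d) := by
            rw [integral_const_mul]
            exact mul_le_mul_of_nonneg_left (hd x ⟨hx.1, h.1⟩ v) hq.le
        _ ≤ q * W x - min c (q * d) := by linarith [min_le_right c (q * d)]
    · have hZx : Z x = V x := if_neg h
      simp only [hZx, if_neg h]
      have := integral_mono (hZi x (σ x) v)
        (hV.integrable (measurable_nextPosition_right x (σ x) v)) fun o => hZV _
      linarith [hc x hx v, min_le_left c (q * d)]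

lemma exists_barrier {D : Set (E N)} {γ : ℝ} (a : ℝ) (hγ : 0 < γ) {x₀ : E N}
    (hcork : ExteriorCorkscrew D x₀) :
    ∃ θ ∈ Ioo (0 : ℝ) 1, ∀ (n : ℕ) (δ : ℝ), 0 < δ → ∃ R ≤ δ, ∃ δ' ∈ Ioo (0 : ℝ) R,
      ∀ᶠ ε in nhdsWithin (0 : ℝ) (Ioi 0),
        ∃ V σ, IsBarrier D γ a ε x₀ R δ' (θ ^ (n + 1)) V σ := by
  obtain ⟨μ, hμ, r₀, hr₀, hcork⟩ := hcork
  obtain ⟨θ, hθ, hbar⟩ := exists_barrier_of_ball (N := N) a hγ hμ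
  have hball : ∀ r ∈ Ioo (0 : ℝ) r₀, ∀ᶠ ε in nhdsWithin (0 : ℝ) (Ioi 0),
      ∃ V σ, IsBarrier D γ a ε x₀ (4 * r) r θ V σ := by
    intro r hr
    obtain ⟨y, hy⟩ := hcork r hr
    refine hbar D x₀ y r hr.1 ?_ fun x hx => ?_
    · exact mem_ball_iff_norm.1 (hy (mem_ball_self (mul_pos hμ.1 hr.1))).1
    · by_contra! h
      exact (hy (mem_ball_iff_norm.2 h)).2 (subset_closure hx)
  refine ⟨θ, hθ, fun n => ?_⟩
  -- The inner barrier occupies radius `4r`; the factor `8` leaves room `4r` for one step.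
  have hbase : ∀ δ : ℝ, 0 < δ → ∃ r, 0 < r ∧ 8 * r ≤ δ ∧ r < r₀ := fun δ hδ =>
    ⟨min (δ / 8) (r₀ / 2), by positivity, by linarith [min_le_left (δ / 8) (r₀ / 2)],
      by linarith [min_le_right (δ / 8) (r₀ / 2)]⟩
  induction n with
  | zero =>
    intro δ hδ
    obtain ⟨r, hr0, hrδ, hr⟩ := hbase δ hδ
    refine ⟨4 * r, by linarith, r, ⟨hr0, by linarith⟩, ?_⟩
    simpa using hball r ⟨hr0, hr⟩
  | succ n ih =>
    intro δ hδ
    obtain ⟨R, hR, δ', hδ', hV⟩ := ih δ hδ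
    obtain ⟨r, hr0, hrδ, hr⟩ := hbase δ' hδ'.1
    refine ⟨R, hR, r, ⟨hr0, by linarith [hδ'.2]⟩, ?_⟩
    filter_upwards [hV, hball r ⟨hr0, hr⟩, self_mem_nhdsWithin,
      eventually_mul_le (1 + γ + γ * |a - 1|) (c := 4 * r) (by positivity)] with
      ε ⟨V, σ, hV⟩ ⟨W, ρ, hW⟩ hε hstep
    rw [pow_succ]
    exact ⟨_, _, IsBarrier.glue hγ.le (le_of_lt hε) (pow_pos hθ.1 _) hδ'.2.le (by linarith) hV hW
      (by linarith)⟩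

/-! ### Histories: measurability and independence of the next round. -/

lemma position_succ (γ a ε : ℝ) (x : E N) (σI σII : Strategy N) (n : ℕ) (ω : Path N) :
    position γ a ε x σI σII (n + 1) ω
      = nextPosition γ a ε (position γ a ε x σI σII n ω)
        (σI.move n (history γ a ε x σI σII ω n)) (σII.move n (history γ a ε x σI σII ω n))
        (ω n) := by
  simp only [position, history, History.current, Fin.snoc_last]
  rfl

lemma measurable_current (n : ℕ) : Measurable (History.current (N := N) n) := by
  cases n with
  | zero => exact measurable_fst
  | succ n => exact ((measurable_pi_apply (Fin.last n)).comp measurable_snd).fst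

lemma history_snd_succ (γ a ε : ℝ) (x : E N) (σI σII : Strategy N) (n : ℕ) (ω : Path N) :
    history γ a ε x σI σII ω (n + 1) = ((history γ a ε x σI σII ω n).1,
      Fin.snoc (history γ a ε x σI σII ω n).2 (position γ a ε x σI σII (n + 1) ω, ω n)) := by
  simp only [position, history, History.current, Fin.snoc_last]

lemma measurable_history (γ a ε : ℝ) (x : E N) (σI σII : Strategy N) (n : ℕ) :
    Measurable fun ω => history γ a ε x σI σII ω n := by
  induction n with
  | zero => exact measurable_const
  | succ n ih =>
    have hpos : Measurable (position γ a ε x σI σII (n + 1)) := by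
      simp only [funext fun ω => position_succ γ a ε x σI σII n ω]
      exact measurable_nextPosition ((measurable_current n).comp ih)
        ((σI.measurable_move n).comp ih) ((σII.measurable_move n).comp ih)
        (measurable_pi_apply n)
    simp only [history_snd_succ]
    refine ih.fst.prodMk (measurable_pi_iff.2 fun i => ?_)
    induction i using Fin.lastCases with
    | last =>
      simp only [Fin.snoc_last]
      exact hpos.prodMk (measurable_pi_apply n)
    | cast i =>
      simp only [Fin.snoc_castSucc]
      exact (measurable_pi_apply i).comp ih.snd

lemma measurable_position (γ a ε : ℝ) (x : E N) (σI σII : Strategy N) (n : ℕ) :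
    Measurable (position γ a ε x σI σII n) :=
  (measurable_current n).comp (measurable_history γ a ε x σI σII n)

lemma history_congr (γ a ε : ℝ) (x : E N) (σI σII : Strategy N) {n : ℕ} {ω ω' : Path N}
    (h : ∀ j < n, ω j = ω' j) :
    history γ a ε x σI σII ω n = history γ a ε x σI σII ω' n := by
  induction n with
  | zero => rfl
  | succ n ih =>
    have := ih fun j hj => h j (hj.trans n.lt_succ_self)
    simp only [history, this, h n n.lt_succ_self]

instance : Nonempty (Outcome N) :=
  ⟨⟨0, mem_ball_self one_pos⟩, 0, ⟨1 / 2, by norm_num, by norm_num⟩⟩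

instance : IsProbabilityMeasure (gameMeasure N) := by
  unfold gameMeasure
  infer_instance

/-- A function of the path that depends on the first `n` rounds only is independent of round
`n + 1`. -/
lemma indepFun_of_dependsOn {β : Type*} [MeasurableSpace β] {n : ℕ} {f : Path N → β}
    (hf : Measurable f) (hdep : ∀ ω ω' : Path N, (∀ j < n, ω j = ω' j) → f ω = f ω') :
    ProbabilityTheory.IndepFun f (fun ω => ω n) (gameMeasure N) := by
  have hind : ProbabilityTheory.iIndepFun (fun (i : ℕ) (ω : Path N) => ω i) (gameMeasure N) :=
    ProbabilityTheory.iIndepFun_infinitePi (X := fun _ o => o) fun _ => measurable_id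
  have h := hind.indepFun_finset (Finset.range n) {n} (by simp) fun i => measurable_pi_apply i
  -- Padding the first `n` rounds by a fixed outcome exhibits `f` as a function of these rounds
  -- alone.
  let ext : (Finset.range n → Outcome N) → Path N := fun u j =>
    if hj : j ∈ Finset.range n then u ⟨j, hj⟩ else Classical.arbitrary _
  have hext : Measurable ext := by
    refine measurable_pi_iff.2 fun j => ?_
    by_cases hj : j ∈ Finset.range n
    · simp only [ext, dif_pos hj]
      exact measurable_pi_apply _
    · simp only [ext, dif_neg hj]
      exact measurable_const
  have h2 := h.comp (hf.comp hext)
    (measurable_pi_apply (⟨n, Finset.mem_singleton_self n⟩ : ({n} : Finset ℕ)))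
  convert h2 using 1
  · funext ω
    refine hdep _ _ fun j hj => ?_
    simp [ext, hj]
  · rfl

lemma integral_round {β : Type*} [MeasurableSpace β] {n : ℕ} {f : Path N → β}
    (hf : Measurable f) (hdep : ∀ ω ω' : Path N, (∀ j < n, ω j = ω' j) → f ω = f ω')
    {F : β × Outcome N → ℝ} (hF : Measurable F) {C : ℝ} (h0 : ∀ z, 0 ≤ F z)
    (hC : ∀ z, F z ≤ C) :
    Integrable (fun ω => ∫ o, F (f ω, o) ∂roundMeasure N) (gameMeasure N) ∧
    ∫ ω, F (f ω, ω n) ∂gameMeasure N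
      = ∫ ω, ∫ o, F (f ω, o) ∂roundMeasure N ∂gameMeasure N := by
  have hlast : Measurable fun ω : Path N => ω n := measurable_pi_apply n
  have hind := (ProbabilityTheory.indepFun_iff_map_prod_eq_prod_map_map hf.aemeasurable
    hlast.aemeasurable).1 (indepFun_of_dependsOn hf hdep)
  have hround : (gameMeasure N).map (fun ω => ω n) = roundMeasure N :=
    (measurePreserving_eval_infinitePi (fun _ : ℕ => roundMeasure N) n).map_eq
  have := Measure.isProbabilityMeasure_map (μ := gameMeasure N) hf.aemeasurable
  have hi : Integrable F (((gameMeasure N).map f).prod (roundMeasure N)) :=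
    integrable_of_bounded hF h0 hC
  have hm := hi.integral_prod_left
  refine ⟨(integrable_map_measure hm.aestronglyMeasurable hf.aemeasurable).1 hm, ?_⟩
  rw [← integral_map (f := F) (hf.prodMk hlast).aemeasurable hF.aestronglyMeasurable, hind, hround,
    integral_prod _ hi, integral_map hf.aemeasurable hm.aestronglyMeasurable]

/-! ### From barriers to stopping probabilities. -/

/-- The strategy that plays the move prescribed by the current position. -/
def markovStrategy (σ : E N → ball (0 : E N) 1) (hσ : Measurable σ) : Strategy N where
  move n h := σ (h.current n)
  measurable_move n := hσ.comp (measurable_current n)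

/-- The event that the first `n` positions lie in `S`. -/
def staysIn (γ a ε : ℝ) (x : E N) (σI σII : Strategy N) (S : Set (E N)) (n : ℕ) :
    Set (Path N) :=
  {ω | ∀ j < n, position γ a ε x σI σII j ω ∈ S}

lemma measurableSet_staysIn (γ a ε : ℝ) (x : E N) (σI σII : Strategy N) {S : Set (E N)}
    (hS : MeasurableSet S) (n : ℕ) : MeasurableSet (staysIn γ a ε x σI σII S n) := by
  have : staysIn γ a ε x σI σII S n = ⋂ j, ⋂ (_ : j < n), position γ a ε x σI σII j ⁻¹' S := by
    ext ω
    simp [staysIn]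
  rw [this]
  exact MeasurableSet.iInter fun j => MeasurableSet.iInter fun _ =>
    measurable_position γ a ε x σI σII j hS

lemma staysIn_succ {γ a ε : ℝ} {x : E N} {σI σII : Strategy N} {S : Set (E N)} {n : ℕ}
    {ω : Path N} : ω ∈ staysIn γ a ε x σI σII S (n + 1) ↔
      ω ∈ staysIn γ a ε x σI σII S n ∧ position γ a ε x σI σII n ω ∈ S := by
  simp only [staysIn, mem_ofPred_eq]
  exact Nat.forall_lt_succ_right

/-- Off `D` the scaled distance vanishes while `t > 0`, so the game stops by round `n + 1`; an
earlier stop also happens in `B`. -/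
lemma mem_stopsIn {D : Set (E N)} {γ a ε : ℝ} {x : E N} {σI σII : Strategy N} {B : Set (E N)}
    (hε : 0 < ε) {n : ℕ} {ω : Path N} (hin : ω ∈ staysIn γ a ε x σI σII B n)
    (hB : position γ a ε x σI σII n ω ∈ B) (hD : position γ a ε x σI σII n ω ∉ D) :
    ω ∈ stopsIn D γ a ε x σI σII B := by
  set T : Set ℕ∞ := {m : ℕ∞ | ∃ n : ℕ, m = (n : ℕ∞) + 1 ∧
    scaledDist D ε (position γ a ε x σI σII n ω) < ((ω n).2.2 : ℝ)} with hT
  have hmem : (n : ℕ∞) + 1 ∈ T := by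
    refine ⟨n, rfl, ?_⟩
    rw [scaledDist, infDist_zero_of_mem (by exact hD), min_eq_right hε.le, mul_zero]
    exact (ω n).2.2.2.1
  obtain ⟨k, hk, -⟩ := csInf_mem (⟨_, hmem⟩ : T.Nonempty)
  have hle : (k : ℕ∞) + 1 ≤ (n : ℕ∞) + 1 := hk ▸ csInf_le' hmem
  have hkn : k ≤ n := Nat.le_of_succ_le_succ (by exact_mod_cast hle)
  refine ⟨k, hk, ?_⟩
  rcases hkn.lt_or_eq with h | rfl
  · exact hin k h
  · exact hB

section Markov

variable {D : Set (E N)} {γ a ε : ℝ} {x₀ : E N} {δ δ' q : ℝ} {V : E N → ℝ}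
  {σ : E N → ball (0 : E N) 1}

lemma IsBarrier.setIntegral_succ_le (hDm : MeasurableSet D)
    (h : IsBarrier D γ a ε x₀ δ δ' q V σ) {c : ℝ}
    (hc : ∀ x ∈ D ∩ ball x₀ δ, ∀ v,
      ∫ o, V (nextPosition γ a ε x (σ x) v o) ∂roundMeasure N ≤ V x - c)
    (x : E N) (σII : Strategy N) (n : ℕ) :
    ∫ ω in staysIn γ a ε x (markovStrategy σ h.measurable_move) σII (D ∩ ball x₀ δ) (n + 1),
        V (position γ a ε x (markovStrategy σ h.measurable_move) σII (n + 1) ω) ∂gameMeasure N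
      ≤ ∫ ω in staysIn γ a ε x (markovStrategy σ h.measurable_move) σII (D ∩ ball x₀ δ) (n + 1),
        (V (position γ a ε x (markovStrategy σ h.measurable_move) σII n ω) - c)
          ∂gameMeasure N := by
  classical
  set σI := markovStrategy σ h.measurable_move
  set S := D ∩ ball x₀ δ
  set A := staysIn γ a ε x σI σII S (n + 1) with hA
  have hAm : MeasurableSet A :=
    measurableSet_staysIn γ a ε x σI σII (hDm.inter measurableSet_ball) (n + 1)
  obtain ⟨C, hC⟩ := h.bounded
  have hC0 : 0 ≤ C := (h.nonneg x).trans (hC x)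
  -- `A` constrains `X_0, …, X_n` only, so both components depend on the first `n` rounds and round
  -- `n + 1` can be integrated out.
  let f : Path N → History N n × Prop := fun ω => (history γ a ε x σI σII ω n, ω ∈ A)
  have hf : Measurable f := (measurable_history γ a ε x σI σII n).prodMk hAm.mem
  have hdep : ∀ ω ω' : Path N, (∀ j < n, ω j = ω' j) → f ω = f ω' := by
    intro ω ω' hω
    have hh : ∀ j ≤ n, history γ a ε x σI σII ω j = history γ a ε x σI σII ω' j := fun j hj =>
      history_congr γ a ε x σI σII fun i hi => hω i (hi.trans_le hj)
    refine Prod.ext (hh n le_rfl) (propext (forall_congr' fun j => forall_congr' fun hj => ?_))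
    rw [position, position, hh j (Nat.lt_succ_iff.1 hj)]
  let F : (History N n × Prop) × Outcome N → ℝ := fun z =>
    if z.1.2 then V (nextPosition γ a ε (z.1.1.current n) (σ (z.1.1.current n))
      (σII.move n z.1.1) z.2) else 0
  have hF : Measurable F := by
    have hcur : Measurable fun z : (History N n × Prop) × Outcome N => z.1.1.current n :=
      (measurable_current n).comp measurable_fst.fst
    exact Measurable.ite (measurableSet_setOfPred.2 measurable_fst.snd)
      (h.measurable.comp (measurable_nextPosition hcur (h.measurable_move.comp hcur)
        ((σII.measurable_move n).comp measurable_fst.fst) measurable_snd)) measurable_const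
  obtain ⟨hint, heq⟩ := integral_round hf hdep hF (C := C)
    (fun z => by simp only [F]; split_ifs <;> simp [h.nonneg])
    (fun z => by simp only [F]; split_ifs <;> simp [hC, hC0])
  rw [← integral_indicator hAm, ← integral_indicator hAm]
  have h1 : ∀ ω, A.indicator (fun ω => V (position γ a ε x σI σII (n + 1) ω)) ω
      = F (f ω, ω n) := by
    intro ω
    simp only [F, f, indicator_apply, position_succ]
    rfl
  simp only [h1, heq]
  refine integral_mono hint (((h.integrable (measurable_position γ a ε x σI σII n)).sub
    (integrable_const c)).indicator hAm) fun ω => ?_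
  by_cases hω : ω ∈ A
  · simp only [F, f, indicator_of_mem hω, if_pos hω]
    exact hc _ (staysIn_succ.1 hω).2 _
  · simp [F, f, indicator_of_notMem hω, if_neg hω]

lemma IsBarrier.one_sub_le_prob_stopsIn (hDm : MeasurableSet D) (hε : 0 < ε)
    (h : IsBarrier D γ a ε x₀ δ δ' q V σ) (x : E N) (σII : Strategy N) :
    1 - V x ≤ (gameMeasure N).real
      (stopsIn D γ a ε x (markovStrategy σ h.measurable_move) σII (ball x₀ δ)) := by
  obtain ⟨c, hc0, hc⟩ := h.decrease
  have hstep := h.setIntegral_succ_le hDm hc x σII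
  set σI := markovStrategy σ h.measurable_move
  set A := staysIn γ a ε x σI σII (D ∩ ball x₀ δ)
  set X := position γ a ε x σI σII
  have hX : ∀ n, Measurable (X n) := measurable_position γ a ε x σI σII
  have hAm : ∀ n, MeasurableSet (A n) :=
    measurableSet_staysIn γ a ε x σI σII (hDm.inter measurableSet_ball)
  set bad : ℕ → Set (Path N) := fun n => A n ∩ X n ⁻¹' (ball x₀ δ)ᶜ
  have hbad : ∀ n, MeasurableSet (bad n) := fun n =>
    (hAm n).inter (hX n measurableSet_ball.compl)
  have hVX : ∀ n, Integrable (fun ω => V (X n ω)) (gameMeasure N) := fun n =>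
    h.integrable (hX n)
  -- `A n` contains the disjoint events `A (n + 1)` and `bad n`; on the latter `V ≥ 1`, and the
  -- remaining paths are dropped since `V ≥ 0`.
  have hdrop : ∀ n, ∫ ω in A (n + 1), V (X (n + 1) ω) ∂gameMeasure N
      + (c * (gameMeasure N).real (A (n + 1)) + (gameMeasure N).real (bad n))
      ≤ ∫ ω in A n, V (X n ω) ∂gameMeasure N := by
    intro n
    have h1 := hstep n
    rw [integral_sub (hVX n).integrableOn (integrable_const c), setIntegral_const, smul_eq_mul,
      mul_comm] at h1
    have hdisj : Disjoint (A (n + 1)) (bad n) :=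
      disjoint_left.2 fun ω h1 h2 => h2.2 (staysIn_succ.1 h1).2.2
    have h2 : ∫ ω in A (n + 1) ∪ bad n, V (X n ω) ∂gameMeasure N
        ≤ ∫ ω in A n, V (X n ω) ∂gameMeasure N :=
      setIntegral_mono_set (hVX n).integrableOn
        (Filter.Eventually.of_forall fun ω => h.nonneg _)
        (union_subset (fun ω h1 => (staysIn_succ.1 h1).1) inter_subset_left).eventuallyLE
    rw [setIntegral_union hdisj (hbad n) (hVX n).integrableOn (hVX n).integrableOn] at h2
    have h3 : (gameMeasure N).real (bad n) ≤ ∫ ω in bad n, V (X n ω) ∂gameMeasure N := by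
      have := setIntegral_mono_on (integrable_const (1 : ℝ)).integrableOn (hVX n).integrableOn
        (hbad n) fun ω hω => h.one_le _ hω.2
      simpa using this
    linarith
  have hsum : ∀ n, ∫ ω in A n, V (X n ω) ∂gameMeasure N
      + ∑ j ∈ Finset.range n, (c * (gameMeasure N).real (A (j + 1))
        + (gameMeasure N).real (bad j)) ≤ V x := by
    intro n
    induction n with
    | zero =>
      have hA0 : A 0 = univ := eq_univ_of_forall fun ω j hj => absurd hj j.not_lt_zero
      have hX0 : ∀ ω, X 0 ω = x := fun ω => rfl
      simp [hA0, hX0]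
    | succ n ih =>
      rw [Finset.sum_range_succ]
      linarith [hdrop n]
  have hcount : ∀ n : ℕ, n * (c * (gameMeasure N).real (A n))
      + ∑ j ∈ Finset.range n, (gameMeasure N).real (bad j) ≤ V x := by
    intro n
    have h1 := hsum n
    rw [Finset.sum_add_distrib] at h1
    have h2 : ∑ _j ∈ Finset.range n, c * (gameMeasure N).real (A n)
        ≤ ∑ j ∈ Finset.range n, c * (gameMeasure N).real (A (j + 1)) := by
      refine Finset.sum_le_sum fun j hj => mul_le_mul_of_nonneg_left (measureReal_mono ?_) hc0.le
      exact fun ω hω i hi => hω i (by have := Finset.mem_range.1 hj; omega)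
    have h3 : 0 ≤ ∫ ω in A n, V (X n ω) ∂gameMeasure N :=
      integral_nonneg fun ω => h.nonneg _
    simp only [Finset.sum_const, Finset.card_range, nsmul_eq_mul] at h2
    linarith
  -- Split by the first exit from `D ∩ B(x₀, δ)`: none before time `n`, out of the ball, or out of
  -- `D` within the ball.
  have hcover : ∀ n, univ ⊆ stopsIn D γ a ε x σI σII (ball x₀ δ) ∪
      (A n ∪ ⋃ j ∈ Finset.range n, bad j) := by
    classical
    intro n ω _
    by_cases hω : ω ∈ A n
    · exact Or.inr (Or.inl hω)
    · have hex : ∃ j, j < n ∧ X j ω ∉ D ∩ ball x₀ δ := by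
        simpa [A, staysIn] using hω
      obtain ⟨hm, hmX⟩ := Nat.find_spec hex
      have hmA : ω ∈ A (Nat.find hex) := fun j hj => by
        by_contra hj'
        exact Nat.find_min hex hj ⟨hj.trans hm, hj'⟩
      by_cases hB : X (Nat.find hex) ω ∈ ball x₀ δ
      · exact Or.inl (mem_stopsIn hε (fun j hj => (hmA j hj).2) hB fun hD => hmX ⟨hD, hB⟩)
      · exact Or.inr (Or.inr (mem_biUnion (Finset.mem_coe.2 (Finset.mem_range.2 hm)) ⟨hmA, hB⟩))
  have hprob : ∀ n, 1 ≤ (gameMeasure N).real (stopsIn D γ a ε x σI σII (ball x₀ δ))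
      + ((gameMeasure N).real (A n) + ∑ j ∈ Finset.range n, (gameMeasure N).real (bad j)) := by
    intro n
    calc (1 : ℝ) = (gameMeasure N).real univ := probReal_univ.symm
      _ ≤ _ := measureReal_mono (hcover n)
      _ ≤ _ := (measureReal_union_le _ _).trans (add_le_add le_rfl
        ((measureReal_union_le _ _).trans
          (add_le_add le_rfl (measureReal_biUnion_finset_le _ _))))
  refine le_of_forall_pos_le_add fun e he => ?_
  obtain ⟨n, hn⟩ := exists_nat_gt (V x / (c * e))
  have hce : 0 < c * e := mul_pos hc0 he
  rw [div_lt_iff₀ hce] at hn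
  have hsum0 : 0 ≤ ∑ j ∈ Finset.range n, (gameMeasure N).real (bad j) :=
    Finset.sum_nonneg fun j _ => measureReal_nonneg
  have hA0 : 0 ≤ (n : ℝ) * (c * (gameMeasure N).real (A n)) := by positivity
  have hAn : (gameMeasure N).real (A n) ≤ e := by
    by_contra! hlt
    have : (n : ℝ) * (c * e) ≤ n * (c * (gameMeasure N).real (A n)) := by gcongr
    linarith [hcount n]
  linarith [hprob n, hcount n]

end Markov

end TugOfWar

theorem theorem6p2 (N : ℕ) (p γ a : ℝ) (hp : 1 < p) (hγ : 0 < γ) (ha : 0 < a)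
    (hscale : ((N : ℝ) + 2) / γ ^ 2 + a ^ 2 = p - 1)
    (hterm : (a ≤ 1 ∧ 1 < γ * a) ∨ (1 ≤ a ∧ 1 < γ))
    (D : Set (EuclideanSpace ℝ (Fin N))) (hDopen : IsOpen D)
    (hDbdd : Bornology.IsBounded D) (hDconn : IsConnected D)
    (x₀ : EuclideanSpace ℝ (Fin N)) (hx₀ : x₀ ∈ frontier D)
    (hcork : TugOfWar.ExteriorCorkscrew D x₀) :
    TugOfWar.GameRegular D γ a x₀ := by
  intro η hη δ hδ
  obtain ⟨θ, hθ, hbar⟩ := TugOfWar.exists_barrier a hγ hcork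
  -- The number of nested scales depends on `η` alone and is fixed before `ε`.
  obtain ⟨n, hn⟩ := exists_pow_lt_of_lt_one hη hθ.2
  obtain ⟨R, hR, δ', hδ', hV⟩ := hbar n δ hδ
  obtain ⟨u, hu, hV⟩ := mem_nhdsGT_iff_exists_Ioo_subset.1 hV
  refine ⟨δ', ⟨hδ'.1, hδ'.2.trans_le hR⟩, min u (1 / 2), ⟨lt_min hu (by norm_num),
    (min_le_right _ _).trans_lt (by norm_num)⟩, fun ε hε x hx => ?_⟩
  obtain ⟨V, σ, h⟩ := hV ⟨hε.1, hε.2.trans_le (min_le_left _ _)⟩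
  refine ⟨TugOfWar.markovStrategy σ h.measurable_move, fun σII => ?_⟩
  have hle : θ ^ (n + 1) ≤ θ ^ n := pow_le_pow_of_le_one hθ.1.le hθ.2.le n.le_succ
  calc 1 - η ≤ 1 - V x := by linarith [h.le x hx]
    _ ≤ _ := h.one_sub_le_prob_stopsIn hDopen.measurableSet hε.1 x σII
    _ ≤ _ := by
      refine MeasureTheory.measureReal_mono ?_
      rintro ω ⟨k, hk, hmem⟩
      exact ⟨k, hk, Metric.ball_subset_ball hR hmem⟩
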